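/- Let $k, r, t$ be positive integers with $2r+1 \le t$ and $t \ge 6r-5$. Let $S_t^r$ be the graph on $t$ vertices obtained from the star $K_{1,t-1}$ by adding $r$ pairwise disjoint edges between leaves, so that it consists of $r$ triangles and $t-2r-1$ pendent edges sharing one common vertex. Let $gr_k(K_3; S_t^r)$ be the least integer $n$ such that every colouring of the edges of the complete graph $K_n$ with colours from a set of $k$ colours contains a rainbow triangle (three edges of pairwise distinct colours) or a monochromatic copy of $S_t^r$. Then $gr_k(K_3;S_t^r)$ exists, and $$ 2(t-1)\cdot 5^{\frac{k-2}{2}}+1 \;\le\; gr_k(K_3;S_t^{r}) \;\le\; [2t+8(r-1)]\cdot 5^{\frac{k-2}{2}}-4(r-1) \quad\text{if $k$ is even,} $$ $$ (t-1)\cdot 5^{\frac{k-1}{2}}+1 \;\le\; gr_k(K_3;S_t^{r}) \;\le\; [t+4(r-1)]\cdot 5^{\frac{k-1}{2}}-4(r-1) \quad\text{if $k$ is odd.} $$ -/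

import Mathlib

namespace GallaiRamsey

/-- The graph `S_t^r` on the vertex set `{0, …, t - 1}`: the star of order `t` with centre `0`,
together with the `r` independent edges `{1, 2}, {3, 4}, …, {2r - 1, 2r}` between its leaves.
It is meant for `2 * r + 1 ≤ t`, so that all these leaves exist. -/
def starWithEdges (t r : ℕ) : SimpleGraph (Fin t) :=
  SimpleGraph.fromRel fun a b =>
    a.val = 0 ∨ ∃ j < r, a.val = 2 * j + 1 ∧ b.val = 2 * j + 2

/-- The edge colouring `C` of a complete graph contains a rainbow copy of `G`: a copy of `G` on
which no two edges have the same colour. -/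
def HasRainbowCopy {V K W : Type*} (C : SimpleGraph.TopEdgeLabeling V K)
    (G : SimpleGraph W) : Prop :=
  ∃ f : G.Copy (⊤ : SimpleGraph V),
    Function.Injective fun e : G.edgeSet => C (f.mapEdgeSet e)

/-- The edge colouring `C` of a complete graph contains a monochromatic copy of `H`. -/
def HasMonochromaticCopy {V K W : Type*} (C : SimpleGraph.TopEdgeLabeling V K)
    (H : SimpleGraph W) : Prop :=
  ∃ i : K, H.IsContained (C.labelGraph i)

/-- The orders `n` such that every colouring of the edges of `K_n` with colours from a fixed set
of `k` colours contains a rainbow copy of `G` or a monochromatic copy of `H`. -/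
def gallaiRamseySet {W W' : Type*} (k : ℕ) (G : SimpleGraph W) (H : SimpleGraph W') : Set ℕ :=
  {n | ∀ C : SimpleGraph.TopEdgeLabeling (Fin n) (Fin k),
    HasRainbowCopy C G ∨ HasMonochromaticCopy C H}

/-- The `k`-coloured Gallai-Ramsey number `gr_k(G : H)`, the least element of
`gallaiRamseySet k G H` (whenever that set is nonempty). -/
noncomputable def gallaiRamseyNumber {W W' : Type*} (k : ℕ) (G : SimpleGraph W)
    (H : SimpleGraph W') : ℕ :=
  sInf (gallaiRamseySet k G H)

end GallaiRamsey

/-!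
In a colouring without monochromatic `S_t^{s+1}`, the neighbourhood of a vertex in colour `a`, once
it has at least `t - 1` elements, contains no `s + 1` disjoint edges of colour `a`; so all but `2s`
of its vertices span no edge of colour `a`, and they carry a colouring with one colour less. A
colouring without rainbow triangles has a partition into modules with at most two colours between
them (Gallai), and this sparse-neighbourhood argument, applied inside a module and in the two
neighbourhoods of one of its vertices, gives the recursion `f (k + 2) = 5 f k + 16 s` for the upper
bound, with `f 1 = t` and `f 2 = 2t + 4s`.

For the lower bound, `K_{t-1}` in one colour is substituted repeatedly into the 2-colouring of `K_5`
without monochromatic triangles, and once into a single edge if the number of colours is even. The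
new colour classes are triangle-free, whereas `S_t^r` is connected and contains a triangle.
-/

namespace GallaiRamsey

open SimpleGraph Finset

variable {V V' W Q K L : Type*}

/-! ### Gallai partitions -/

/-- A Gallai colouring: no triangle has three distinct colours. The condition is stated at the
vertex `x` of the triangle where two edges of distinct colours meet. -/
def IsGallai (C : TopEdgeLabeling V K) : Prop :=
  ∀ ⦃x y z : V⦄ ⦃i j : K⦄, i ≠ j → (C.labelGraph i).Adj x y → (C.labelGraph j).Adj x z →
    (C.labelGraph i).Adj y z ∨ (C.labelGraph j).Adj y z

/-- The classes of `E` are modules of the graph `G`: a vertex outside a class is adjacent to all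
of its vertices or to none of them. -/
def IsModular (G : SimpleGraph V) (E : Setoid V) : Prop :=
  ∀ ⦃x y z : V⦄, E x y → ¬ E x z → G.Adj x z → G.Adj y z

theorem labelGraph_adj_get (C : TopEdgeLabeling V K) {x y : V} (h : x ≠ y) :
    (C.labelGraph (C.get x y h)).Adj x y :=
  (TopEdgeLabeling.labelGraph_adj x y).2 ⟨h, rfl⟩

theorem eq_of_labelGraph_adj {C : TopEdgeLabeling V K} {i j : K} {x y : V}
    (hi : (C.labelGraph i).Adj x y) (hj : (C.labelGraph j).Adj x y) : i = j := by
  obtain ⟨_, rfl⟩ := (TopEdgeLabeling.labelGraph_adj x y).1 hi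
  obtain ⟨_, rfl⟩ := (TopEdgeLabeling.labelGraph_adj x y).1 hj
  rfl

theorem labelGraph_pullback (C : TopEdgeLabeling V K) (f : V' ↪ V) (i : K) :
    (C.pullback f).labelGraph i = (C.labelGraph i).comap f := by
  ext x y
  rw [TopEdgeLabeling.labelGraph_adj, comap_adj, TopEdgeLabeling.labelGraph_adj]
  exact ⟨fun ⟨h, hi⟩ => ⟨f.injective.ne h, hi⟩, fun ⟨h, hi⟩ => ⟨ne_of_apply_ne f h, hi⟩⟩

theorem IsGallai.pullback {C : TopEdgeLabeling V K} (hC : IsGallai C) (f : V' ↪ V) :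
    IsGallai (C.pullback f) := by
  intro x y z i j hij
  simp only [labelGraph_pullback, comap_adj]
  exact @hC _ _ _ _ _ hij

theorem IsGallai.isModular_reachableSetoid {C : TopEdgeLabeling V K} (hC : IsGallai C) (i j : K) :
    IsModular (C.labelGraph j) (C.labelGraph i).reachableSetoid := by
  rintro x y z ⟨p⟩ hxz hj
  induction p with
  | nil => exact hj
  | @cons x w y hxw _ ih =>
    have hwz : ¬ (C.labelGraph i).Reachable w z := fun h => hxz (hxw.reachable.trans h)
    have hij : i ≠ j := by
      rintro rfl
      exact hxz hj.reachable
    exact ih hwz ((hC hij hxw hj).resolve_left fun h => hwz h.reachable)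

theorem exists_reachable_induce_compl_adj {G : SimpleGraph V} {v w : V} (h : G.Reachable w v)
    (hw : w ∈ ({v}ᶜ : Set V)) :
    ∃ x : ({v}ᶜ : Set V), (G.induce {v}ᶜ).Reachable ⟨w, hw⟩ x ∧ G.Adj v x := by
  obtain ⟨p⟩ := h
  induction p with
  | nil => exact absurd rfl hw
  | @cons w w' v hww' _ ih =>
    by_cases hw' : w' = v
    · subst hw'
      exact ⟨⟨w, hw⟩, .rfl, hww'.symm⟩
    · obtain ⟨x, hx, hvx⟩ := ih hw'
      have hadj : (G.induce {v}ᶜ).Adj ⟨w, hw⟩ ⟨w', hw'⟩ := hww'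
      exact ⟨x, hadj.reachable.trans hx, hvx⟩

/-- Every component of the `a`-coloured graph on `V \ {v}` contains an `a`-neighbour `x` of `v`, and
the triangle on `v`, `u` and `x` is not rainbow. -/
theorem IsGallai.adj_of_not_reachable_induce {C : TopEdgeLabeling V K} (hC : IsGallai C) {v : V}
    {a e : K} (hae : a ≠ e) (ha : (C.labelGraph a).Preconnected) {u w : ({v}ᶜ : Set V)}
    (hvu : (C.labelGraph e).Adj v u)
    (huw : ¬ ((C.labelGraph a).induce {v}ᶜ).Reachable u w) : (C.labelGraph e).Adj u w := by
  have hmod := (hC.pullback (.subtype (· ∈ ({v}ᶜ : Set V)))).isModular_reachableSetoid a e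
  simp only [labelGraph_pullback] at hmod
  obtain ⟨x, hwx, hvx⟩ := exists_reachable_induce_compl_adj (ha w v) w.2
  have hux : ¬ ((C.labelGraph a).induce {v}ᶜ).Reachable u x := fun h => huw (h.trans hwx.symm)
  have hxu : (C.labelGraph e).Adj x u := (hC hae hvx hvu).resolve_left fun h =>
    hux (Adj.reachable (G := (C.labelGraph a).induce {v}ᶜ) h).symm
  exact (hmod hwx.symm (fun h => hux (.symm h)) hxu).symm

theorem IsGallai.preconnected_induce_compl [Nontrivial V] {C : TopEdgeLabeling V K}
    (hC : IsGallai C) (v : V) {a b d : K} (hab : a ≠ b) (had : a ≠ d) (hbd : b ≠ d)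
    (ha : (C.labelGraph a).Preconnected) (hb : (C.labelGraph b).Preconnected)
    (hd : (C.labelGraph d).Preconnected) : ((C.labelGraph a).induce {v}ᶜ).Preconnected := by
  by_contra hcon
  obtain ⟨u, hvu⟩ := exists_adj_iff_not_isIsolated.2 (hb.not_isIsolated v)
  obtain ⟨u', hvu'⟩ := exists_adj_iff_not_isIsolated.2 (hd.not_isIsolated v)
  lift u to ({v}ᶜ : Set V) using hvu.ne'
  lift u' to ({v}ᶜ : Set V) using hvu'.ne'
  by_cases huu' : ((C.labelGraph a).induce {v}ᶜ).Reachable u u'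
  · obtain ⟨w, huw⟩ : ∃ w, ¬ ((C.labelGraph a).induce {v}ᶜ).Reachable u w := by
      by_contra! h
      exact hcon fun x y => (h x).symm.trans (h y)
    have hb' := hC.adj_of_not_reachable_induce hab ha hvu huw
    have hd' := hC.adj_of_not_reachable_induce had ha hvu' fun h => huw (huu'.trans h)
    have hmod := (hC.pullback (.subtype (· ∈ ({v}ᶜ : Set V)))).isModular_reachableSetoid a b
    simp only [labelGraph_pullback] at hmod
    exact hbd (eq_of_labelGraph_adj (hmod huu' huw hb') hd')
  · have hb' := hC.adj_of_not_reachable_induce hab ha hvu huu'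
    have hd' := hC.adj_of_not_reachable_induce had ha hvu' fun h => huu' h.symm
    exact hbd (eq_of_labelGraph_adj hb' hd'.symm)

theorem IsGallai.not_three_preconnected [Finite V] [Nontrivial V] {C : TopEdgeLabeling V K}
    (hC : IsGallai C) {a b d : K} (hab : a ≠ b) (had : a ≠ d) (hbd : b ≠ d)
    (ha : (C.labelGraph a).Preconnected) (hb : (C.labelGraph b).Preconnected) :
    ¬ (C.labelGraph d).Preconnected := by
  intro hd
  induction hn : Nat.card V using Nat.strong_induction_on generalizing V with
  | _ n ih =>
    obtain ⟨v⟩ : Nonempty V := inferInstance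
    obtain ⟨u, hvu⟩ := exists_adj_iff_not_isIsolated.2 (ha.not_isIsolated v)
    obtain ⟨u', hvu'⟩ := exists_adj_iff_not_isIsolated.2 (hb.not_isIsolated v)
    have : Nontrivial ({v}ᶜ : Set V) := by
      refine ⟨⟨u, hvu.ne'⟩, ⟨u', hvu'.ne'⟩, fun h => hab ?_⟩
      obtain rfl : u = u' := congrArg Subtype.val h
      exact eq_of_labelGraph_adj hvu hvu'
    refine ih _ ?_ (hC.pullback (.subtype (· ∈ ({v}ᶜ : Set V)))) ?_ ?_ ?_ rfl
    · rw [← hn]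
      exact Finite.card_subtype_lt (x := v) (by simp)
    all_goals rw [labelGraph_pullback]
    · exact hC.preconnected_induce_compl v hab had hbd ha hb hd
    · exact hC.preconnected_induce_compl v hab.symm hbd had hb ha hd
    · exact hC.preconnected_induce_compl v had.symm hbd.symm hab hd ha hb

theorem IsModular.adj_of_adj {G : SimpleGraph V} {E : Setoid V} (hE : IsModular G E)
    {x x' y y' : V} (hx : E x x') (hy : E y y') (hxy : ¬ E x y) (hadj : G.Adj x y) :
    G.Adj x' y' := by
  have hx'y : ¬ E x' y := fun h => hxy (E.trans hx h)
  exact (hE hy (fun h => hx'y (E.symm h)) (hE hx hxy hadj).symm).symm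

theorem IsModular.comap_mk {G : SimpleGraph V} {E : Setoid V} (hE : IsModular G E)
    {F : Setoid (Quotient E)} (hF : IsModular (G.comap Quotient.out) F) :
    IsModular G (F.comap (Quotient.mk E)) := by
  intro x y z hxy hxz hadj
  have hE' {u w : V} (h : ¬ F (Quotient.mk E u) (Quotient.mk E w)) : ¬ E u w := fun hEuw =>
    h (Quotient.sound (s := E) hEuw ▸ F.refl _)
  have hyz : ¬ F (Quotient.mk E y) (Quotient.mk E z) := fun h => hxz (F.trans hxy h)
  have hmk (u : V) : E (Quotient.mk E u).out u := Quotient.mk_out u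
  have hout := hF hxy hxz (hE.adj_of_adj (E.symm (hmk x)) (E.symm (hmk z)) (hE' hxz) hadj)
  refine hE.adj_of_adj (hmk y) (hmk z) (fun h => hE' hyz ?_) hout
  exact E.trans (E.symm (hmk y)) (E.trans h (hmk z))

theorem exists_maximal_isModular [Finite V] [Nontrivial V] (C : TopEdgeLabeling V K) :
    ∃ E, Maximal (fun E : Setoid V => E ≠ ⊤ ∧ ∀ i, IsModular (C.labelGraph i) E) E := by
  have : Finite (Setoid V) := Finite.of_injective (fun (E : Setoid V) x y => E x y)
    fun E F h => Setoid.ext fun x y => iff_of_eq (congrFun₂ h x y)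
  obtain ⟨x, y, hxy⟩ := exists_pair_ne V
  have hbot : (⊥ : Setoid V) ≠ ⊤ := fun h => hxy (Setoid.eq_top_iff.1 h x y)
  obtain ⟨E, -, hE⟩ := Finite.exists_le_maximal
    (p := fun E : Setoid V => E ≠ ⊤ ∧ ∀ i, IsModular (C.labelGraph i) E) (a := ⊥)
    ⟨hbot, fun _ _ _ _ h _ hadj => h ▸ hadj⟩
  exact ⟨E, hE⟩

/-- Otherwise the components of colour `i` between the classes would give a coarser partition. -/
theorem IsGallai.preconnected_of_maximal {C : TopEdgeLabeling V K} (hC : IsGallai C) {E : Setoid V}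
    (hE : Maximal (fun E : Setoid V => E ≠ ⊤ ∧ ∀ i, IsModular (C.labelGraph i) E) E) {i : K}
    {p q : Quotient E} (hpq : (C.labelGraph i).Adj p.out q.out) :
    ((C.labelGraph i).comap (Quotient.out : Quotient E → V)).Preconnected := by
  set F : Setoid (Quotient E) := ((C.labelGraph i).comap Quotient.out).reachableSetoid
  by_contra hcon
  have hmod (j : K) : IsModular (C.labelGraph j) (F.comap (Quotient.mk E)) := by
    refine (hE.prop.2 j).comap_mk ?_
    have := (hC.pullback ⟨_, Quotient.out_injective (s := E)⟩).isModular_reachableSetoid i j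
    rwa [labelGraph_pullback, labelGraph_pullback] at this
  have hne : F.comap (Quotient.mk E) ≠ ⊤ := fun h => hcon fun p q => by
    have hF := Setoid.eq_top_iff.1 h p.out q.out
    rwa [Setoid.comap_rel, Quotient.out_eq, Quotient.out_eq] at hF
  have hle : E ≤ F.comap (Quotient.mk E) := fun x y h => by
    rw [Setoid.comap_rel, Quotient.sound (s := E) h]
  have hFpq : F.comap (Quotient.mk E) p.out q.out := by
    rw [Setoid.comap_rel, Quotient.out_eq, Quotient.out_eq]
    exact Adj.reachable (G := (C.labelGraph i).comap Quotient.out) hpq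
  have hEpq : E p.out q.out := hE.le_of_ge ⟨hne, hmod⟩ hle hFpq
  exact hpq.ne (congrArg _ (Quotient.out_equiv_out.1 hEpq))

theorem IsGallai.exists_gallai_partition [Finite V] [Nontrivial V] {C : TopEdgeLabeling V K}
    (hC : IsGallai C) :
    ∃ E : Setoid V, E ≠ ⊤ ∧ (∀ i, IsModular (C.labelGraph i) E) ∧
      ∃ a b, ∀ x y, ¬ E x y → (C.labelGraph a).Adj x y ∨ (C.labelGraph b).Adj x y := by
  obtain ⟨E, hE⟩ := exists_maximal_isModular C
  have hcolour {x y : V} (hxy : ¬ E x y) : ∃ i, (C.labelGraph i).Adj x y ∧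
      ((C.labelGraph i).comap (Quotient.out : Quotient E → V)).Preconnected := by
    have hne : x ≠ y := fun h => hxy (h ▸ E.refl x)
    have hadj := labelGraph_adj_get C hne
    exact ⟨_, hadj, hC.preconnected_of_maximal hE <| (hE.prop.2 _).adj_of_adj
      (E.symm (Quotient.mk_out x)) (E.symm (Quotient.mk_out y)) hxy hadj⟩
  refine ⟨E, hE.prop.1, hE.prop.2, ?_⟩
  by_contra! hcon
  obtain ⟨x, y, hxy⟩ : ∃ x y, ¬ E x y := by
    by_contra! h
    exact hE.prop.1 (Setoid.eq_top_iff.2 h)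
  have : Nontrivial (Quotient E) :=
    ⟨Quotient.mk E x, Quotient.mk E y, fun h => hxy (Quotient.exact h)⟩
  obtain ⟨a, -, ha⟩ := hcolour hxy
  obtain ⟨x, y, hxy, hxya, -⟩ := hcon a a
  obtain ⟨b, hxyb, hb⟩ := hcolour hxy
  obtain ⟨z, w, hzw, hzwa, hzwb⟩ := hcon a b
  obtain ⟨d, hzwd, hd⟩ := hcolour hzw
  have hab : a ≠ b := fun h => hxya (h ▸ hxyb)
  have had : a ≠ d := fun h => hzwa (h ▸ hzwd)
  have hbd : b ≠ d := fun h => hzwb (h ▸ hzwd)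
  have hD := hC.pullback ⟨_, Quotient.out_injective (s := E)⟩
  refine hD.not_three_preconnected hab had hbd ?_ ?_ ?_ <;> rwa [labelGraph_pullback]

/-! ### Stars with disjoint edges between the leaves -/

/-- The first `2 * r` entries of the list `l`, taken in consecutive pairs, are the edges of a
matching of `G` (if `l` has no duplicates). -/
def StartsWithMatching (G : SimpleGraph V) (r : ℕ) (l : List V) : Prop :=
  ∀ j < r, ∃ _ : 2 * j + 1 < l.length, G.Adj l[2 * j] l[2 * j + 1]

theorem StartsWithMatching.cons_cons {G : SimpleGraph V} {r : ℕ} {l : List V} {x y : V}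
    (hl : StartsWithMatching G r l) (hxy : G.Adj x y) :
    StartsWithMatching G (r + 1) (x :: y :: l) := by
  rintro (_ | j) hj
  · exact ⟨by simp, hxy⟩
  · obtain ⟨h, hadj⟩ := hl j (by lia)
    exact ⟨by simp only [List.length_cons]; lia, hadj⟩

theorem starWithEdges_isContained {G : SimpleGraph V} {t r : ℕ} {v : V} {l : List V}
    (hl : l.Nodup) (ht : t ≤ l.length + 1) (hv : ∀ x ∈ l, G.Adj v x)
    (hr : StartsWithMatching G r l) : (starWithEdges t r).IsContained G := by
  have hnodup : (v :: l).Nodup := List.nodup_cons.2 ⟨fun h => (hv v h).ne rfl, hl⟩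
  let f (a : Fin t) : V := (v :: l)[a.1]'(by simp only [List.length_cons]; lia)
  have hf : Function.Injective f := fun a b h => Fin.ext (hnodup.getElem_inj_iff.1 h)
  have hadj {a b : Fin t} (hab : a ≠ b)
      (h : a.1 = 0 ∨ ∃ j < r, a.1 = 2 * j + 1 ∧ b.1 = 2 * j + 2) : G.Adj (f a) (f b) := by
    obtain ⟨a, ha⟩ := a
    obtain ⟨b, hb⟩ := b
    rcases h with h | ⟨j, hj, h, h'⟩
    · obtain rfl : a = 0 := h
      obtain ⟨b, rfl⟩ := Nat.exists_eq_succ_of_ne_zero fun h => hab (Fin.ext h.symm)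
      exact hv _ (List.getElem_mem _)
    · obtain rfl : a = 2 * j + 1 := h
      obtain rfl : b = 2 * j + 2 := h'
      exact (hr j hj).2
  refine ⟨⟨⟨f, fun {a b} h => ?_⟩, hf⟩⟩
  obtain ⟨hab, h | h⟩ := (fromRel_adj _ _ _).1 h
  · exact hadj hab h
  · exact (hadj hab.symm h).symm

theorem exists_startsWithMatching_or_isIndepSet [DecidableEq V] (G : SimpleGraph V) (N : Finset V)
    (r : ℕ) :
    (∃ l : List V, l.Nodup ∧ l.toFinset = N ∧ StartsWithMatching G r l) ∨
      ∃ I ⊆ N, G.IsIndepSet I ∧ #N + 2 ≤ #I + 2 * r := by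
  induction r generalizing N with
  | zero => exact .inl ⟨N.toList, N.nodup_toList, N.toList_toFinset, fun _ h => absurd h (by simp)⟩
  | succ r ih =>
    by_cases hN : G.IsIndepSet N
    · exact .inr ⟨N, Subset.rfl, hN, by lia⟩
    obtain ⟨x, hx, y, hy, hxy⟩ : ∃ x ∈ N, ∃ y ∈ N, G.Adj x y := by
      by_contra! h
      exact hN fun x hx y hy _ => h x hx y hy
    have hy' : y ∈ N.erase x := mem_erase.2 ⟨hxy.ne', hy⟩
    rcases ih ((N.erase x).erase y) with ⟨l, hl, hlN, hmatch⟩ | ⟨I, hIN, hI, hcard⟩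
    · refine .inl ⟨x :: y :: l, ?_, ?_, hmatch.cons_cons hxy⟩
      · have hmem (z : V) : z ∈ l ↔ z ≠ y ∧ z ≠ x ∧ z ∈ N := by
          rw [← List.mem_toFinset, hlN, mem_erase, mem_erase]
        simp [hmem, hl, hxy.ne]
      · rw [List.toFinset_cons, List.toFinset_cons, hlN, insert_erase hy', insert_erase hx]
    · refine .inr ⟨I, hIN.trans ((erase_subset _ _).trans (erase_subset _ _)), hI, ?_⟩
      have := card_erase_add_one hx
      have := card_erase_add_one hy'
      lia

theorem card_lt_of_starWithEdges_free {G : SimpleGraph V} {t s m : ℕ}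
    (hfree : (starWithEdges t (s + 1)).Free G) (htm : t ≤ m) {u : V} {N : Finset V}
    (hN : ∀ x ∈ N, G.Adj u x) (hm : ∀ I ⊆ N, G.IsIndepSet I → #I < m) : #N < m + 2 * s := by
  classical
  rcases exists_startsWithMatching_or_isIndepSet G N (s + 1) with
    ⟨l, hl, rfl, hmatch⟩ | ⟨I, hIN, hI, hcard⟩
  · by_contra! hlarge
    rw [List.toFinset_card_of_nodup hl] at hlarge
    have hadj : ∀ x ∈ l, G.Adj u x := fun x hx => hN x (List.mem_toFinset.2 hx)
    exact hfree (starWithEdges_isContained hl (by lia) hadj hmatch)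
  · have := hm I hIN hI
    lia

/-! ### The upper bound -/

section Counting

variable {A B : SimpleGraph V} {E : Setoid V} {t s m : ℕ}

theorem card_lt_of_forall_adj_or_adj [Fintype V] (hA : (starWithEdges t (s + 1)).Free A)
    (hB : (starWithEdges t (s + 1)).Free B) (htm : t ≤ m)
    (hAB : ∀ ⦃x y⦄, x ≠ y → A.Adj x y ∨ B.Adj x y)
    (hmA : ∀ I : Finset V, A.IsIndepSet I → #I < m)
    (hmB : ∀ I : Finset V, B.IsIndepSet I → #I < m) : Fintype.card V < 2 * m + 4 * s := by
  classical
  rcases isEmpty_or_nonempty V with _ | ⟨⟨x⟩⟩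
  · have := hmA ∅ (by simp)
    rw [Fintype.card_eq_zero]
    lia
  have hcover : univ ⊆ {x} ∪ (A.neighborFinset x ∪ B.neighborFinset x) := by
    intro y _
    rcases eq_or_ne x y with rfl | hxy
    · simp
    · simpa using .inr (hAB hxy)
  have hNA : #(A.neighborFinset x) < m + 2 * s :=
    card_lt_of_starWithEdges_free hA htm (u := x) (by simp) fun I _ => hmA I
  have hNB : #(B.neighborFinset x) < m + 2 * s :=
    card_lt_of_starWithEdges_free hB htm (u := x) (by simp) fun I _ => hmB I
  have hcard := (card_le_card hcover).trans (card_union_le _ _)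
  have hunion := card_union_le (A.neighborFinset x) (B.neighborFinset x)
  rw [card_univ, card_singleton] at hcard
  lia

theorem card_lt_of_forall_adj_compl [Fintype V] [DecidableEq V]
    (hA : (starWithEdges t (s + 1)).Free A) (htm : t ≤ m) {S : Finset V}
    (hS : S.Nonempty) (hS' : Sᶜ.Nonempty) (hadj : ∀ x ∈ S, ∀ y ∈ Sᶜ, A.Adj x y)
    (hm : ∀ I : Finset V, A.IsIndepSet I → #I < m) : Fintype.card V < 2 * m + 4 * s := by
  obtain ⟨x, hx⟩ := hS
  obtain ⟨y, hy⟩ := hS'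
  have hlt : #Sᶜ < m + 2 * s := card_lt_of_starWithEdges_free hA htm (hadj x hx) fun I _ => hm I
  have hlt' : #S < m + 2 * s :=
    card_lt_of_starWithEdges_free hA htm (fun z hz => (hadj z hz y hy).symm) fun I _ => hm I
  have := card_add_card_compl S
  lia

theorem card_lt_of_isIndepSet (hB : (starWithEdges t (s + 1)).Free B) (htm : t ≤ m)
    (hm : ∀ I : Finset V, A.IsIndepSet I → B.IsIndepSet I → #I < m) {I : Finset V}
    (hI : A.IsIndepSet I) {u : V} (hu : ∀ x ∈ I, B.Adj u x) : #I < m + 2 * s :=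
  card_lt_of_starWithEdges_free hB htm hu fun J hJI hJ => hm J (hI.mono (coe_subset.2 hJI)) hJ

theorem card_class_lt_of_isModular [Fintype V] [DecidableRel E]
    (hA : (starWithEdges t (s + 1)).Free A) (hB : (starWithEdges t (s + 1)).Free B) (htm : t ≤ m)
    (hEA : IsModular A E) (hEB : IsModular B E)
    (hm : ∀ I : Finset V, A.IsIndepSet I → B.IsIndepSet I → #I < m)
    {x y z : V} (hxy : ¬ E x y) (hAxy : A.Adj x y) (hxz : ¬ E x z) (hBxz : B.Adj x z) :
    #{w | E x w} < m + 4 * s := by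
  have hlt : #{w | E x w} < m + 2 * s + 2 * s :=
    card_lt_of_starWithEdges_free hA (by lia)
      (fun w hw => (hEA (mem_filter.1 hw).2 hxy hAxy).symm) fun I hIE hI =>
        card_lt_of_isIndepSet hB htm hm hI
          fun w hw => (hEB (mem_filter.1 (hIE hw)).2 hxz hBxz).symm
  lia

/-- A subset of the neighbourhood without edges of `A` splits into its part in the class of one of
its vertices `y` and the rest, which consists of `B`-neighbours of `y`. -/
theorem degree_lt_of_isModular (hA : (starWithEdges t (s + 1)).Free A)
    (hB : (starWithEdges t (s + 1)).Free B) (htm : t ≤ m) (hEB : IsModular B E)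
    (hAB : ∀ ⦃x y⦄, ¬ E x y → A.Adj x y ∨ B.Adj x y)
    (hm : ∀ I : Finset V, A.IsIndepSet I → B.IsIndepSet I → #I < m)
    (hnB : ∀ x, ∃ y, ¬ E x y ∧ B.Adj x y) (x : V)
    [Fintype (A.neighborSet x)] : A.degree x < 2 * m + 6 * s := by
  classical
  have hindep (I : Finset V) (hI : A.IsIndepSet I) : #I < 2 * m + 4 * s := by
    have hmpos : 0 < m := (Nat.zero_le _).trans_lt (hm ∅ (by simp) (by simp))
    rcases I.eq_empty_or_nonempty with rfl | ⟨y, hy⟩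
    · rw [card_empty]
      lia
    obtain ⟨z, hyz, hByz⟩ := hnB y
    have hsub (p : V → Prop) [DecidablePred p] : A.IsIndepSet (I.filter p) :=
      hI.mono (coe_subset.2 (filter_subset p I))
    have hin : #{w ∈ I | E y w} < m + 2 * s :=
      card_lt_of_isIndepSet hB htm hm (hsub _) fun w hw =>
        (hEB (mem_filter.1 hw).2 hyz hByz).symm
    have hout : #{w ∈ I | ¬ E y w} < m + 2 * s :=
      card_lt_of_isIndepSet hB htm hm (hsub _) fun w hw => by
        obtain ⟨hwI, hyw⟩ := mem_filter.1 hw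
        have hne : y ≠ w := fun h => hyw (h ▸ E.refl y)
        exact (hAB hyw).resolve_left (hI hy hwI hne)
    have := card_filter_add_card_filter_not (s := I) (E y)
    lia
  have hlt : #(A.neighborFinset x) < 2 * m + 4 * s + 2 * s :=
    card_lt_of_starWithEdges_free hA (by lia) (u := x) (by simp) fun I _ => hindep I
  rw [card_neighborFinset_eq_degree] at hlt
  lia

theorem card_lt_of_isModular [Fintype V] (hA : (starWithEdges t (s + 1)).Free A)
    (hB : (starWithEdges t (s + 1)).Free B) (htm : t ≤ m) (hEA : IsModular A E)
    (hEB : IsModular B E) (hAB : ∀ ⦃x y⦄, ¬ E x y → A.Adj x y ∨ B.Adj x y)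
    (hm : ∀ I : Finset V, A.IsIndepSet I → B.IsIndepSet I → #I < m)
    (hnA : ∀ x, ∃ y, ¬ E x y ∧ A.Adj x y) (hnB : ∀ x, ∃ y, ¬ E x y ∧ B.Adj x y) :
    Fintype.card V < 5 * m + 16 * s := by
  classical
  rcases isEmpty_or_nonempty V with _ | ⟨⟨x⟩⟩
  · have := hm ∅ (by simp) (by simp)
    rw [Fintype.card_eq_zero]
    lia
  have hcover : univ ⊆ univ.filter (E x) ∪ (A.neighborFinset x ∪ B.neighborFinset x) := by
    intro y _
    simpa using (em (E x y)).imp_right (@hAB x y)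
  obtain ⟨y, hxy, hAxy⟩ := hnA x
  obtain ⟨z, hxz, hBxz⟩ := hnB x
  have hclass := card_class_lt_of_isModular hA hB htm hEA hEB hm hxy hAxy hxz hBxz
  have hNA := degree_lt_of_isModular hA hB htm hEB hAB hm hnB x
  have hNB := degree_lt_of_isModular hB hA htm hEA (fun x y h => (hAB h).symm)
    (fun I hIB hIA => hm I hIA hIB) hnA x
  have hcard := (card_le_card hcover).trans (card_union_le _ _)
  have hunion := card_union_le (A.neighborFinset x) (B.neighborFinset x)
  simp only [card_univ, card_neighborFinset_eq_degree] at hcard hunion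
  lia

end Counting

/-- A Gallai colouring which uses only colours from the set `P` and has no monochromatic copy
of `H`. -/
structure IsGallaiAvoiding (C : TopEdgeLabeling V K) (P : Finset K) (H : SimpleGraph W) :
    Prop where
  isGallai : IsGallai C
  mem_of_adj : ∀ ⦃i x y⦄, (C.labelGraph i).Adj x y → i ∈ P
  free : ∀ i, H.Free (C.labelGraph i)

theorem IsGallaiAvoiding.restrict {C : TopEdgeLabeling V K} {P Q : Finset K} {H : SimpleGraph W}
    (hC : IsGallaiAvoiding C P H) {I : Finset V}
    (hI : ∀ i ∈ P, i ∉ Q → (C.labelGraph i).IsIndepSet I) :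
    IsGallaiAvoiding (C.pullback (.subtype (· ∈ I))) Q H where
  isGallai := hC.isGallai.pullback _
  mem_of_adj i x y h := by
    rw [labelGraph_pullback, comap_adj] at h
    by_contra hi
    exact hI i (hC.mem_of_adj h) hi x.2 y.2 (Adj.ne h) h
  free i h := by
    rw [labelGraph_pullback] at h
    exact hC.free i (h.trans ⟨(Embedding.comap _ _).toCopy⟩)

theorem IsGallaiAvoiding.card_lt_step [Fintype V] [Nontrivial V] {C : TopEdgeLabeling V K}
    {P : Finset K} {t s m m' : ℕ} (hC : IsGallaiAvoiding C P (starWithEdges t (s + 1)))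
    (htm : t ≤ m) (htm' : t ≤ m')
    (hm : ∀ a ∈ P, ∀ I : Finset V, (C.labelGraph a).IsIndepSet I → #I < m)
    (hm' : ∀ a ∈ P, ∀ b ∈ P, a ≠ b → ∀ I : Finset V, (C.labelGraph a).IsIndepSet I →
      (C.labelGraph b).IsIndepSet I → #I < m') :
    Fintype.card V < 2 * m + 4 * s ∨ Fintype.card V < 5 * m' + 16 * s := by
  classical
  obtain ⟨E, hE, hmod, a, b, hab⟩ := hC.isGallai.exists_gallai_partition
  by_cases hc : ∃ c x, ∀ y, ¬ E x y → (C.labelGraph c).Adj x y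
  · obtain ⟨c, x, hc⟩ := hc
    left
    obtain ⟨y, hxy⟩ : ∃ y, ¬ E x y := by
      by_contra! h
      exact hE (Setoid.eq_top_iff.2 fun y z => E.trans (E.symm (h y)) (h z))
    refine card_lt_of_forall_adj_compl (S := {y | E x y}) (hC.free c) htm ⟨x, by simp⟩
      ⟨y, by simpa using hxy⟩ (fun z hz w hw => ?_) (hm c (hC.mem_of_adj (hc y hxy)))
    have hxw : ¬ E x w := by simpa using hw
    exact hmod c (by simpa using hz) hxw (hc w hxw)
  · right
    push Not at hc
    have hnA (x : V) : ∃ y, ¬ E x y ∧ (C.labelGraph a).Adj x y :=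
      (hc b x).imp fun y hy => ⟨hy.1, (hab x y hy.1).resolve_right hy.2⟩
    have hnB (x : V) : ∃ y, ¬ E x y ∧ (C.labelGraph b).Adj x y :=
      (hc a x).imp fun y hy => ⟨hy.1, (hab x y hy.1).resolve_left hy.2⟩
    obtain ⟨x⟩ : Nonempty V := inferInstance
    obtain ⟨y, -, hAxy⟩ := hnA x
    obtain ⟨z, -, hBxz⟩ := hnB x
    have hne : a ≠ b := by
      rintro rfl
      obtain ⟨w, hxw, hw⟩ := hc a x
      exact hw ((hab x w hxw).elim id id)
    exact card_lt_of_isModular (hC.free a) (hC.free b) htm' (hmod a) (hmod b) hab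
      (hm' a (hC.mem_of_adj hAxy) b (hC.mem_of_adj hBxz) hne) hnA hnB

theorem IsGallaiAvoiding.card_lt_of_singleton [Fintype V] {C : TopEdgeLabeling V K} {a : K}
    {t r : ℕ} (hC : IsGallaiAvoiding C {a} (starWithEdges t r)) : Fintype.card V < t := by
  by_contra! ht
  have htop : C.labelGraph a = ⊤ := by
    ext x y
    refine ⟨fun h => h.ne, fun h => ?_⟩
    have hadj := labelGraph_adj_get C h
    rwa [mem_singleton.1 (hC.mem_of_adj hadj)] at hadj
  refine hC.free a ?_
  rw [htop]
  exact isContained_top_iff.2 (Function.Embedding.nonempty_of_card_le (by simpa using ht))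

/-- The upper bound for the order which forces a monochromatic copy of `starWithEdges t (s + 1)`
in a Gallai colouring. The value at `k` is the bound for `k + 1` colours. -/
def orderBound (t s : ℕ) : ℕ → ℕ
  | 0 => t
  | 1 => 2 * t + 4 * s
  | k + 2 => 5 * orderBound t s k + 16 * s

theorem le_orderBound (t s : ℕ) : ∀ k, t ≤ orderBound t s k
  | 0 => le_rfl
  | 1 => by rw [orderBound]; lia
  | k + 2 => by
    have := le_orderBound t s k
    rw [orderBound]
    lia

theorem two_mul_orderBound_le (t s : ℕ) :
    ∀ k, 2 * orderBound t s k + 4 * s ≤ orderBound t s (k + 1)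
  | 0 => le_rfl
  | 1 => by simp only [orderBound]; lia
  | k + 2 => by
    have := two_mul_orderBound_le t s k
    simp only [orderBound] at this ⊢
    lia

theorem orderBound_two_mul (t s j : ℕ) :
    orderBound t s (2 * j) + 4 * s = (t + 4 * s) * 5 ^ j := by
  induction j with
  | zero => simp [orderBound]
  | succ j ih =>
    rw [mul_add_one, orderBound, pow_succ, ← mul_assoc, ← ih]
    ring

theorem orderBound_two_mul_add_one (t s j : ℕ) :
    orderBound t s (2 * j + 1) + 4 * s = (2 * t + 8 * s) * 5 ^ j := by
  induction j with
  | zero => simp only [orderBound]; ring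
  | succ j ih =>
    rw [show 2 * (j + 1) + 1 = 2 * j + 1 + 2 by ring, orderBound, pow_succ, ← mul_assoc, ← ih]
    ring

theorem IsGallaiAvoiding.card_lt_orderBound [Fintype V] {C : TopEdgeLabeling V K}
    {P : Finset K} {t s k : ℕ} (hC : IsGallaiAvoiding C P (starWithEdges t (s + 1))) (ht : 2 ≤ t)
    (hP : #P = k + 1) : Fintype.card V < orderBound t s k := by
  classical
  induction k using Nat.twoStepInduction generalizing V P with
  | zero =>
    obtain ⟨a, rfl⟩ := card_eq_one.1 hP
    exact hC.card_lt_of_singleton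
  | one =>
    obtain ⟨a, b, -, rfl⟩ := card_eq_two.1 hP
    have hcover {x y : V} (hxy : x ≠ y) : (C.labelGraph a).Adj x y ∨ (C.labelGraph b).Adj x y := by
      have hadj := labelGraph_adj_get C hxy
      rcases mem_insert.1 (hC.mem_of_adj hadj) with h | h
      · exact .inl (h ▸ hadj)
      · exact .inr (mem_singleton.1 h ▸ hadj)
    have hindep {c d : K} (hcd : ({a, b} : Finset K) ⊆ {c, d}) (I : Finset V)
        (hI : (C.labelGraph c).IsIndepSet I) : #I < t := by
      simpa using IsGallaiAvoiding.card_lt_of_singleton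
        (hC.restrict (Q := {d}) (I := I) fun i hi hid => by
          obtain rfl : i = c := by simpa [notMem_singleton.1 hid] using hcd hi
          exact hI)
    exact card_lt_of_forall_adj_or_adj (hC.free a) (hC.free b) le_rfl (@hcover)
      (hindep Subset.rfl) (hindep (pair_comm a b).subset)
  | more k ih ih' =>
    rcases subsingleton_or_nontrivial V with _ | _
    · have := Fintype.card_le_one_iff_subsingleton.2 ‹Subsingleton V›
      have := le_orderBound t s (k + 2)
      lia
    have hm (a : K) (ha : a ∈ P) (I : Finset V) (hI : (C.labelGraph a).IsIndepSet I) :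
        #I < orderBound t s (k + 1) := by
      have hcard : #(P.erase a) = k + 1 + 1 := by rw [card_erase_of_mem ha, hP]; rfl
      simpa using ih' (hC.restrict (I := I) fun i hi hia => by
        obtain rfl : i = a := by simpa [hi] using hia
        exact hI) hcard
    have hm' (a : K) (ha : a ∈ P) (b : K) (hb : b ∈ P) (hab : a ≠ b) (I : Finset V)
        (hIa : (C.labelGraph a).IsIndepSet I) (hIb : (C.labelGraph b).IsIndepSet I) :
        #I < orderBound t s k := by
      have hcard : #((P.erase a).erase b) = k + 1 := by
        rw [card_erase_of_mem (mem_erase.2 ⟨hab.symm, hb⟩), card_erase_of_mem ha, hP]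
        rfl
      simpa using ih (hC.restrict (I := I) fun i hi hiab => by
        obtain rfl | rfl : i = b ∨ i = a := by
          simpa [hi, or_iff_not_imp_left] using hiab
        exacts [hIb, hIa]) hcard
    have hle := two_mul_orderBound_le t s (k + 1)
    rcases hC.card_lt_step (le_orderBound t s (k + 1)) (le_orderBound t s k) hm hm' with h | h
    · exact h.trans_le hle
    · exact h

/-! ### Rainbow triangles -/

theorem injective_edgeSet_top_fin_three_iff {f : (⊤ : SimpleGraph (Fin 3)).edgeSet → K} :
    Function.Injective f ↔ f ⟨s(0, 1), by decide⟩ ≠ f ⟨s(0, 2), by decide⟩ ∧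
      f ⟨s(0, 1), by decide⟩ ≠ f ⟨s(1, 2), by decide⟩ ∧
      f ⟨s(0, 2), by decide⟩ ≠ f ⟨s(1, 2), by decide⟩ := by
  have hedge : ∀ e ∈ (⊤ : SimpleGraph (Fin 3)).edgeSet,
      e = s(0, 1) ∨ e = s(0, 2) ∨ e = s(1, 2) := by
    decide
  refine ⟨fun hf => ⟨?_, ?_, ?_⟩, fun ⟨h, h', h''⟩ => ?_⟩
  · exact hf.ne (by decide)
  · exact hf.ne (by decide)
  · exact hf.ne (by decide)
  · rintro ⟨e, he⟩ ⟨e', he'⟩ heq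
    rcases hedge e he with rfl | rfl | rfl <;> rcases hedge e' he' with rfl | rfl | rfl <;>
      first | rfl | exact absurd heq ‹_› | exact absurd heq.symm ‹_›

theorem hasRainbowCopy_top_iff {C : TopEdgeLabeling V K} :
    HasRainbowCopy C (⊤ : SimpleGraph (Fin 3)) ↔ ¬ IsGallai C := by
  constructor
  · rintro ⟨f, hf⟩ hC
    obtain ⟨h, h', h''⟩ := injective_edgeSet_top_fin_three_iff.1 hf
    have hadj {p q : Fin 3} (hpq : p ≠ q) := labelGraph_adj_get C (f.injective.ne hpq)
    have h01 := hadj (p := 0) (q := 1) (by decide)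
    have h02 := hadj (p := 0) (q := 2) (by decide)
    have h12 := hadj (p := 1) (q := 2) (by decide)
    rcases hC h h01 h02 with hadj | hadj
    · exact h' (eq_of_labelGraph_adj hadj h12)
    · exact h'' (eq_of_labelGraph_adj hadj h12)
  · intro hC
    simp only [IsGallai, not_forall, not_or] at hC
    obtain ⟨x, y, z, i, j, hij, hxy, hxz, hi, hj⟩ := hC
    have hyz : y ≠ z := by
      rintro rfl
      exact hij (eq_of_labelGraph_adj hxy hxz)
    have hinj : Function.Injective ![x, y, z] := by
      simp [Function.Injective, Fin.forall_fin_succ, hxy.ne, hxy.ne', hxz.ne, hxz.ne', hyz,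
        hyz.symm]
    refine ⟨(Embedding.completeGraph ⟨_, hinj⟩).toCopy, injective_edgeSet_top_fin_three_iff.2 ?_⟩
    obtain ⟨_, rfl⟩ := (TopEdgeLabeling.labelGraph_adj x y).1 hxy
    obtain ⟨_, rfl⟩ := (TopEdgeLabeling.labelGraph_adj x z).1 hxz
    simp only [TopEdgeLabeling.labelGraph_adj, not_exists] at hi hj
    exact ⟨hij, fun h => hi hyz h.symm, fun h => hj hyz h.symm⟩

theorem mem_gallaiRamseySet_iff {k n : ℕ} {H : SimpleGraph W} :
    n ∈ gallaiRamseySet k (⊤ : SimpleGraph (Fin 3)) H ↔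
      ∀ C : TopEdgeLabeling (Fin n) (Fin k), ¬ IsGallaiAvoiding C univ H := by
  refine forall_congr' fun C => ?_
  rw [hasRainbowCopy_top_iff, ← imp_iff_not_or]
  refine ⟨fun h hC => ?_, fun h hC => ?_⟩
  · obtain ⟨i, hi⟩ := h hC.isGallai
    exact hC.free i hi
  · by_contra hmono
    exact h ⟨hC, fun _ _ _ _ => mem_univ _, fun i hi => hmono ⟨i, hi⟩⟩

theorem orderBound_mem_gallaiRamseySet {t : ℕ} (ht : 2 ≤ t) (s k : ℕ) :
    orderBound t s k ∈
      gallaiRamseySet (k + 1) (⊤ : SimpleGraph (Fin 3)) (starWithEdges t (s + 1)) := by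
  refine mem_gallaiRamseySet_iff.2 fun C hC => ?_
  simpa using hC.card_lt_orderBound ht (k := k) (by simp)

/-! ### The lower bound -/

theorem IsGallaiAvoiding.notMem_gallaiRamseySet [Fintype V] [Fintype K] {H : SimpleGraph W}
    {C : TopEdgeLabeling V K} (hC : IsGallaiAvoiding C univ H) {n : ℕ} (hn : n ≤ Fintype.card V) :
    n ∉ gallaiRamseySet (Fintype.card K) (⊤ : SimpleGraph (Fin 3)) H := by
  obtain ⟨f⟩ : Nonempty (Fin n ↪ V) := Function.Embedding.nonempty_of_card_le (by simpa using hn)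
  let e := Fintype.equivFin K
  let D : TopEdgeLabeling (Fin n) (Fin (Fintype.card K)) := (C.pullback f).compRight e
  have hD (i : Fin (Fintype.card K)) : D.labelGraph i = (C.labelGraph (e.symm i)).comap f := by
    rw [← labelGraph_pullback]
    ext x y
    simp [D, TopEdgeLabeling.labelGraph_adj, Equiv.eq_symm_apply]
  refine fun hmem => mem_gallaiRamseySet_iff.1 hmem D ⟨?_, fun _ _ _ _ => mem_univ _, fun i h => ?_⟩
  · intro x y z i j hij
    simp only [hD, comap_adj]
    exact @hC.isGallai _ _ _ _ _ (e.symm.injective.ne hij)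
  · rw [hD] at h
    exact hC.free _ (h.trans ⟨(Embedding.comap _ _).toCopy⟩)

theorem lt_gallaiRamseyNumber {H : SimpleGraph W} {k n : ℕ}
    (hn : n ∉ gallaiRamseySet k (⊤ : SimpleGraph (Fin 3)) H)
    (hne : (gallaiRamseySet k (⊤ : SimpleGraph (Fin 3)) H).Nonempty) :
    n < gallaiRamseyNumber k (⊤ : SimpleGraph (Fin 3)) H := by
  by_contra! hle
  simp only [mem_gallaiRamseySet_iff, not_forall, not_not] at hn
  obtain ⟨C, hC⟩ := hn
  have hnotMem := hC.notMem_gallaiRamseySet (n := gallaiRamseyNumber k ⊤ H) (by simpa using hle)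
  rw [Fintype.card_fin] at hnotMem
  exact hnotMem (Nat.sInf_mem hne)

theorem isGallai_of_card_le_two [Fintype K] (hK : Fintype.card K ≤ 2) (C : TopEdgeLabeling V K) :
    IsGallai C := by
  intro x y z i j hij hxy hxz
  have hyz : y ≠ z := by
    rintro rfl
    exact hij (eq_of_labelGraph_adj hxy hxz)
  have hadj := labelGraph_adj_get C hyz
  by_contra! hcon
  refine hK.not_gt (Fintype.two_lt_card_iff.2 ⟨i, j, C.get y z hyz, hij, ?_, ?_⟩)
  · exact fun h => hcon.1 (h ▸ hadj)
  · exact fun h => hcon.2 (h ▸ hadj)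

theorem notMem_gallaiRamseySet_one [Fintype W] {H : SimpleGraph W} {n : ℕ}
    (hn : n < Fintype.card W) : n ∉ gallaiRamseySet 1 (⊤ : SimpleGraph (Fin 3)) H := by
  intro hmem
  refine mem_gallaiRamseySet_iff.1 hmem (fun _ => 0)
    ⟨isGallai_of_card_le_two (by simp) _, fun _ _ _ _ => mem_univ _, fun i ⟨f⟩ => ?_⟩
  have := Fintype.card_le_of_injective f f.injective
  rw [Fintype.card_fin] at this
  lia

/-- The substitution of a copy of the colouring `C` for every vertex of the colouring `D`, the
two sets of colours being kept disjoint. -/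
def blowUp [DecidableEq Q] (D : TopEdgeLabeling Q L) (C : TopEdgeLabeling V K) :
    TopEdgeLabeling (Q × V) (L ⊕ K) :=
  EdgeLabeling.mk
    (fun x y hxy => if h : x.1 = y.1 then .inr (C.get x.2 y.2 fun h' => hxy (Prod.ext h h'))
      else .inl (D.get x.1 y.1 h))
    (fun x y _ => by
      by_cases h : x.1 = y.1
      · rw [dif_pos h, dif_pos h.symm, EdgeLabeling.get_comm]
      · rw [dif_neg h, dif_neg (Ne.symm h), EdgeLabeling.get_comm])

section BlowUp

variable [DecidableEq Q] {D : TopEdgeLabeling Q L} {C : TopEdgeLabeling V K}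

theorem labelGraph_blowUp_inl (j : L) :
    (blowUp D C).labelGraph (.inl j) = (D.labelGraph j).comap Prod.fst := by
  ext x y
  simp only [TopEdgeLabeling.labelGraph_adj, comap_adj, blowUp, EdgeLabeling.get_mk]
  by_cases h : x.1 = y.1
  · simp [h]
  · have hne : x ≠ y := ne_of_apply_ne _ h
    simp [h, hne]

theorem labelGraph_blowUp_inr_adj (i : K) (x y : Q × V) :
    ((blowUp D C).labelGraph (.inr i)).Adj x y ↔ x.1 = y.1 ∧ (C.labelGraph i).Adj x.2 y.2 := by
  simp only [TopEdgeLabeling.labelGraph_adj, blowUp, EdgeLabeling.get_mk]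
  by_cases h : x.1 = y.1
  · simp [h, Prod.ext_iff]
  · simp [h]

theorem IsGallai.blowUp (hD : IsGallai D) (hC : IsGallai C) :
    IsGallai (GallaiRamsey.blowUp D C) := by
  rintro ⟨p, x⟩ ⟨q, y⟩ ⟨s, z⟩ (i | i) (j | j) hij <;>
    simp only [labelGraph_blowUp_inl, labelGraph_blowUp_inr_adj, comap_adj]
  · exact @hD _ _ _ _ _ (by simpa using hij)
  · rintro hpq ⟨rfl, -⟩
    exact .inl hpq.symm
  · rintro ⟨rfl, -⟩ hps
    exact .inr hps
  · rintro ⟨rfl, hxy⟩ ⟨rfl, hxz⟩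
    simpa using hC (by simpa using hij) hxy hxz

theorem free_labelGraph_blowUp_inl {H : SimpleGraph W} (hH : ¬ H.CliqueFree 3) {j : L}
    (hD : (D.labelGraph j).CliqueFree 3) : H.Free ((blowUp D C).labelGraph (.inl j)) := by
  rintro ⟨f⟩
  obtain ⟨g⟩ := (not_cliqueFree_iff_top_isContained 3).1 hH
  rw [labelGraph_blowUp_inl] at f
  let h : (⊤ : SimpleGraph (Fin 3)) →g D.labelGraph j :=
    (Hom.comap Prod.fst _).comp (f.toHom.comp g.toHom)
  exact IsContained.not_cliqueFree ⟨⟨h, h.injective_of_top_hom⟩⟩ hD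

theorem free_labelGraph_blowUp_inr {H : SimpleGraph W} (hH : H.Preconnected) {i : K}
    (hC : H.Free (C.labelGraph i)) : H.Free ((blowUp D C).labelGraph (.inr i)) := by
  rintro ⟨f⟩
  have hadj {u w : W} (h : H.Adj u w) := (labelGraph_blowUp_inr_adj i _ _).1 (f.toHom.map_adj h)
  have hfst (u w : W) : (f u).1 = (f w).1 := by
    obtain ⟨p⟩ := hH u w
    induction p with
    | nil => rfl
    | cons h _ ih => exact (hadj h).1.trans ih
  refine hC ⟨⟨⟨fun u => (f u).2, fun h => (hadj h).2⟩, fun u w h => ?_⟩⟩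
  exact f.injective (Prod.ext (hfst u w) h)

end BlowUp

theorem mul_notMem_gallaiRamseySet [Fintype Q] [Fintype L] {D : TopEdgeLabeling Q L}
    (hD : IsGallai D) (hD' : ∀ j, (D.labelGraph j).CliqueFree 3) {H : SimpleGraph W}
    (hH : H.Preconnected) (hH' : ¬ H.CliqueFree 3) {k n : ℕ}
    (hn : n ∉ gallaiRamseySet k (⊤ : SimpleGraph (Fin 3)) H) :
    Fintype.card Q * n ∉
      gallaiRamseySet (Fintype.card L + k) (⊤ : SimpleGraph (Fin 3)) H := by
  classical
  simp only [mem_gallaiRamseySet_iff, not_forall, not_not] at hn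
  obtain ⟨C, hC⟩ := hn
  have hDC : IsGallaiAvoiding (blowUp D C) univ H :=
    { isGallai := hD.blowUp hC.isGallai
      mem_of_adj := fun _ _ _ _ => mem_univ _
      free := Sum.rec (fun j => free_labelGraph_blowUp_inl hH' (hD' j))
        fun i => free_labelGraph_blowUp_inr hH (hC.free i) }
  simpa using hDC.notMem_gallaiRamseySet (n := Fintype.card Q * n) (by simp)

section Substitution

variable {H : SimpleGraph W} {k n : ℕ}

theorem two_mul_notMem_gallaiRamseySet (hH : H.Preconnected) (hH' : ¬ H.CliqueFree 3)
    (hn : n ∉ gallaiRamseySet k (⊤ : SimpleGraph (Fin 3)) H) :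
    2 * n ∉ gallaiRamseySet (k + 1) (⊤ : SimpleGraph (Fin 3)) H := by
  let D : TopEdgeLabeling (Fin 2) (Fin 1) := fun _ => 0
  have hmul := mul_notMem_gallaiRamseySet (isGallai_of_card_le_two (by simp) D)
    (fun j => cliqueFree_of_card_lt (by simp)) hH hH' hn
  simpa [add_comm] using hmul

theorem five_mul_notMem_gallaiRamseySet (hH : H.Preconnected) (hH' : ¬ H.CliqueFree 3)
    (hn : n ∉ gallaiRamseySet k (⊤ : SimpleGraph (Fin 3)) H) :
    5 * n ∉ gallaiRamseySet (k + 2) (⊤ : SimpleGraph (Fin 3)) H := by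
  have hfree : ∀ j, ((cycleGraph 5).toTopEdgeLabeling.labelGraph j).CliqueFree 3 := by
    rw [Fin.forall_fin_two, toTopEdgeLabeling_labelGraph, toTopEdgeLabeling_labelGraph_compl]
    simp only [← cliqueFinset_eq_empty_iff]
    decide
  have hmul := mul_notMem_gallaiRamseySet (isGallai_of_card_le_two (by simp) _) hfree hH hH' hn
  simpa [add_comm] using hmul

theorem mul_five_pow_notMem_gallaiRamseySet (hH : H.Preconnected) (hH' : ¬ H.CliqueFree 3)
    (hn : n ∉ gallaiRamseySet k (⊤ : SimpleGraph (Fin 3)) H) (j : ℕ) :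
    n * 5 ^ j ∉ gallaiRamseySet (k + 2 * j) (⊤ : SimpleGraph (Fin 3)) H := by
  induction j with
  | zero => simpa using hn
  | succ j ih =>
    have hmul := five_mul_notMem_gallaiRamseySet hH hH' ih
    rwa [show 5 * (n * 5 ^ j) = n * 5 ^ (j + 1) by ring] at hmul

end Substitution

section StarWithEdges

variable {t r : ℕ}

theorem preconnected_starWithEdges (ht : 1 ≤ t) : (starWithEdges t r).Preconnected := by
  have huniv : (starWithEdges t r).IsUniversal ⟨0, ht⟩ := fun x hx => by
    simpa [starWithEdges] using hx
  exact (Connected.of_isUniversal huniv).preconnected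

theorem not_cliqueFree_starWithEdges (ht : 3 ≤ t) (hr : 1 ≤ r) :
    ¬ (starWithEdges t r).CliqueFree 3 := by
  refine (is3Clique_iff.2 ⟨⟨0, by lia⟩, ⟨1, by lia⟩, ⟨2, by lia⟩, ?_, ?_, ?_, rfl⟩).not_cliqueFree
  · simp [starWithEdges]
  · simp [starWithEdges]
  · exact ⟨by simp, .inl (.inr ⟨0, hr, rfl, rfl⟩)⟩

theorem mul_five_pow_notMem_gallaiRamseySet_starWithEdges (ht : 3 ≤ t) (hr : 1 ≤ r) (j : ℕ) :
    (t - 1) * 5 ^ j ∉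
      gallaiRamseySet (2 * j + 1) (⊤ : SimpleGraph (Fin 3)) (starWithEdges t r) := by
  have hbase : t - 1 ∉ gallaiRamseySet 1 (⊤ : SimpleGraph (Fin 3)) (starWithEdges t r) :=
    notMem_gallaiRamseySet_one (by rw [Fintype.card_fin]; lia)
  rw [add_comm]
  exact mul_five_pow_notMem_gallaiRamseySet (preconnected_starWithEdges (by lia))
    (not_cliqueFree_starWithEdges ht hr) hbase j

theorem two_mul_mul_five_pow_notMem_gallaiRamseySet_starWithEdges (ht : 3 ≤ t) (hr : 1 ≤ r)
    (j : ℕ) : 2 * (t - 1) * 5 ^ j ∉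
      gallaiRamseySet (2 * j + 2) (⊤ : SimpleGraph (Fin 3)) (starWithEdges t r) := by
  have h := two_mul_notMem_gallaiRamseySet (preconnected_starWithEdges (by lia))
    (not_cliqueFree_starWithEdges ht hr) (mul_five_pow_notMem_gallaiRamseySet_starWithEdges ht hr j)
  rwa [← mul_assoc] at h

end StarWithEdges

end GallaiRamsey

open GallaiRamsey in
theorem theorem1p4_general (k t r : ℕ) (hk : 1 ≤ k) (hr : 1 ≤ r) (hrt : 2 * r + 1 ≤ t) :
    (GallaiRamsey.gallaiRamseySet k (⊤ : SimpleGraph (Fin 3))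
      (GallaiRamsey.starWithEdges t r)).Nonempty ∧
    (Even k →
      2 * ((t : ℤ) - 1) * 5 ^ ((k - 2) / 2) + 1 ≤
        (GallaiRamsey.gallaiRamseyNumber k (⊤ : SimpleGraph (Fin 3))
          (GallaiRamsey.starWithEdges t r) : ℤ) ∧
      (GallaiRamsey.gallaiRamseyNumber k (⊤ : SimpleGraph (Fin 3))
          (GallaiRamsey.starWithEdges t r) : ℤ) ≤
        (2 * (t : ℤ) + 8 * ((r : ℤ) - 1)) * 5 ^ ((k - 2) / 2) - 4 * ((r : ℤ) - 1)) ∧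
    (Odd k →
      ((t : ℤ) - 1) * 5 ^ ((k - 1) / 2) + 1 ≤
        (GallaiRamsey.gallaiRamseyNumber k (⊤ : SimpleGraph (Fin 3))
          (GallaiRamsey.starWithEdges t r) : ℤ) ∧
      (GallaiRamsey.gallaiRamseyNumber k (⊤ : SimpleGraph (Fin 3))
          (GallaiRamsey.starWithEdges t r) : ℤ) ≤
        ((t : ℤ) + 4 * ((r : ℤ) - 1)) * 5 ^ ((k - 1) / 2) - 4 * ((r : ℤ) - 1)) := by
  obtain ⟨s, rfl⟩ := Nat.exists_eq_add_of_le' hr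
  have hmem (k : ℕ) := orderBound_mem_gallaiRamseySet (t := t) (by lia) s k
  refine ⟨?_, ?_, ?_⟩
  · obtain ⟨k, rfl⟩ := Nat.exists_eq_add_of_le' hk
    exact ⟨_, hmem k⟩
  · intro hk'
    obtain ⟨j, rfl⟩ : ∃ j, k = 2 * j + 2 := by
      obtain ⟨j, rfl⟩ := hk'.two_dvd
      exact ⟨j - 1, by lia⟩
    have hlower := lt_gallaiRamseyNumber
      (two_mul_mul_five_pow_notMem_gallaiRamseySet_starWithEdges (by lia) hr j) ⟨_, hmem _⟩
    have hupper := (add_le_add_left (Nat.sInf_le (hmem (2 * j + 1))) (4 * s)).trans_eq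
      (orderBound_two_mul_add_one t s j)
    rw [Nat.add_sub_cancel, Nat.mul_div_cancel_left j two_pos]
    zify [show 1 ≤ t by lia] at hlower hupper
    push_cast
    constructor <;> linarith! only [hlower, hupper]
  · rintro ⟨j, rfl⟩
    have hlower := lt_gallaiRamseyNumber
      (mul_five_pow_notMem_gallaiRamseySet_starWithEdges (by lia) hr j) ⟨_, hmem _⟩
    have hupper := (add_le_add_left (Nat.sInf_le (hmem (2 * j))) (4 * s)).trans_eq
      (orderBound_two_mul t s j)
    rw [Nat.add_sub_cancel, Nat.mul_div_cancel_left j two_pos]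
    zify [show 1 ≤ t by lia] at hlower hupper
    push_cast
    constructor <;> linarith! only [hlower, hupper]

theorem theorem1p4 (k t r : ℕ) (hk : 1 ≤ k) (hr : 1 ≤ r) (hrt : 2 * r + 1 ≤ t)
    (ht : 6 * (r : ℤ) - 5 ≤ (t : ℤ)) :
    (GallaiRamsey.gallaiRamseySet k (⊤ : SimpleGraph (Fin 3))
      (GallaiRamsey.starWithEdges t r)).Nonempty ∧
    (Even k →
      2 * ((t : ℤ) - 1) * 5 ^ ((k - 2) / 2) + 1 ≤
        (GallaiRamsey.gallaiRamseyNumber k (⊤ : SimpleGraph (Fin 3))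
          (GallaiRamsey.starWithEdges t r) : ℤ) ∧
      (GallaiRamsey.gallaiRamseyNumber k (⊤ : SimpleGraph (Fin 3))
          (GallaiRamsey.starWithEdges t r) : ℤ) ≤
        (2 * (t : ℤ) + 8 * ((r : ℤ) - 1)) * 5 ^ ((k - 2) / 2) - 4 * ((r : ℤ) - 1)) ∧
    (Odd k →
      ((t : ℤ) - 1) * 5 ^ ((k - 1) / 2) + 1 ≤
        (GallaiRamsey.gallaiRamseyNumber k (⊤ : SimpleGraph (Fin 3))
          (GallaiRamsey.starWithEdges t r) : ℤ) ∧
      (GallaiRamsey.gallaiRamseyNumber k (⊤ : SimpleGraph (Fin 3))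
          (GallaiRamsey.starWithEdges t r) : ℤ) ≤
        ((t : ℤ) + 4 * ((r : ℤ) - 1)) * 5 ^ ((k - 1) / 2) - 4 * ((r : ℤ) - 1)) :=
  theorem1p4_general k t r hk hr hrt
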